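/- Let $G(n)$ be the $n$-by-$n$ square grid graph. For a connected graph $G$ and a spanning tree $T$ of $G$, let $\mathrm{Prob}_{\mathrm{MST}}(T)$ be the probability that $T$ is produced by the algorithm that starts from the empty forest and repeatedly selects a uniformly random not yet selected edge of $G$, adding it unless it would create a cycle. The bipartite graph associated to $T$ has as nodes the edges of $T$ (the set $\mathcal V_1$) and the edges of $G$ not in $T$ (the set $\mathcal V_2$); $b\in\mathcal V_1$ and $c\in\mathcal V_2$ are adjacent if $b$ lies on the unique cycle of $T+c$. The degree-mass function $p$ of $T$ assigns to $d$ the proportion of the nodes in $\mathcal V_2$ that have degree $d$. Let $\mathcal F=\{T_n\}$ be a family of spanning trees $T_n$ of $G(n)$, one for each $n$ in an infinite set of positive integers (for example all of them); all limits below are for $n\to\infty$ within this index set. Suppose that $\mathcal F$ is - bounded: the average degree of the nodes of the bipartite graph associated to $T_n$, divided by $n^2$, tends to $0$; - convergent: the degree-mass functions $p_n$ of $T_n$ converge pointwise to a function $p_\infty$; - neighbor-independent: the proportion of the pairs $(v,w)\in\mathcal V_2\times\mathcal V_2$ (for $T_n$) that have a common neighbor in $\mathcal V_1$ tends to $0$.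 Let $$f(x)=1+x-\sum_{d\ge 3}p_\infty(d)(1-x)^d\quad(x\in[0,1]),\qquad \overline f=\exp\int_0^1\ln f(x)\,dx .$$ Then the series converges on $[0,1]$, $f>0$ on $(0,1]$, $\ln f$ is integrable on $[0,1]$, and the lower decay base $Q^-(\mathcal F)=\liminf_{n\to\infty}\mathrm{Prob}_{\mathrm{MST}}(T_n)^{1/n^2}$ satisfies $$Q^-(\mathcal F)\ \ge\ \frac{1}{e\cdot\overline f}.$$ In other words, $\mathrm{Prob}_{\mathrm{MST}}(T_n)\ge\left(\frac{1}{e\cdot\overline f}+o(1)\right)^{n^2}$. -/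

import Mathlib

open Filter Topology

noncomputable section

namespace GridMST

section Graph

variable {V : Type*} [Fintype V] [DecidableEq V]

/-- A set `T` of edges is (the edge set of) a spanning tree of `G`. -/
def IsSpanningTree (G : SimpleGraph V) (T : Finset (Sym2 V)) : Prop :=
  (T : Set (Sym2 V)) ⊆ G.edgeSet ∧ (SimpleGraph.fromEdgeSet (T : Set (Sym2 V))).IsTree

/-- Try to add the edge `e` to the forest `A`; reject `e` if this would create a cycle. -/
def addEdge (A : Finset (Sym2 V)) (e : Sym2 V) : Finset (Sym2 V) :=
  open scoped Classical in
  if (SimpleGraph.fromEdgeSet ((insert e A : Finset (Sym2 V)) : Set (Sym2 V))).IsAcyclic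
  then insert e A else A

/-- Run (at most) `k` steps of the random greedy algorithm, starting from the forest `A` built so
far and the set `R` of edges not yet selected: each step selects the next edge uniformly at random
from `R`, removes it from `R`, and adds it to the forest unless this would create a cycle. -/
def greedy : ℕ → Finset (Sym2 V) → Finset (Sym2 V) → PMF (Finset (Sym2 V))
  | 0, A, _ => PMF.pure A
  | k + 1, A, R =>
    open scoped Classical in
    if h : R.Nonempty then
      (PMF.uniformOfFinset R h).bind fun e => greedy k (addEdge A e) (R.erase e)
    else PMF.pure A

/-- The edges of `G`, as a finite set. -/
def edges (G : SimpleGraph V) : Finset (Sym2 V) :=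
  open scoped Classical in G.edgeFinset

/-- The minimal spanning tree distribution of `G`: the law of the output of the random greedy
algorithm, started with the empty forest and run until every edge of `G` has been selected. -/
def mstDistribution (G : SimpleGraph V) : PMF (Finset (Sym2 V)) :=
  greedy (edges G).card ∅ (edges G)

/-- The probability of `T` under the minimal spanning tree distribution of `G`. -/
def probMST (G : SimpleGraph V) (T : Finset (Sym2 V)) : ℝ :=
  (mstDistribution G T).toReal

/-- The chords of `T`: the edges of `G` that are not in `T`. -/
def chords (G : SimpleGraph V) (T : Finset (Sym2 V)) : Finset (Sym2 V) :=
  edges G \ T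

/-- The set of edges that lie on a cycle of the graph obtained by adding `c` to `T`. If `T` is a
spanning tree and `c` is a chord, that graph has exactly one cycle, and this is its edge set. -/
def cycle (T : Finset (Sym2 V)) (c : Sym2 V) : Set (Sym2 V) :=
  {b | ∃ (v : V)
      (w : (SimpleGraph.fromEdgeSet ((insert c T : Finset (Sym2 V)) : Set (Sym2 V))).Walk v v),
      w.IsCycle ∧ b ∈ w.edges}

/-- The bipartite graph associated to `T`: its nodes are the branches (left) and the chords (right)
of `T`, and a branch is adjacent to a chord if it belongs to the cycle of the chord. -/
def bipartiteGraph (G : SimpleGraph V) (T : Finset (Sym2 V)) :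
    SimpleGraph (↥T ⊕ ↥(chords G T)) :=
  SimpleGraph.fromRel fun x y =>
    ∃ (b : ↥T) (c : ↥(chords G T)), x = Sum.inl b ∧ y = Sum.inr c ∧ (b : Sym2 V) ∈ cycle T c

/-- The degree of a node of the bipartite graph. -/
def nodeDegree (G : SimpleGraph V) (T : Finset (Sym2 V)) (x : ↥T ⊕ ↥(chords G T)) : ℕ :=
  open scoped Classical in (bipartiteGraph G T).degree x

/-- The average degree over all nodes of the bipartite graph. -/
def averageDegree (G : SimpleGraph V) (T : Finset (Sym2 V)) : ℝ :=
  (∑ x : ↥T ⊕ ↥(chords G T), (nodeDegree G T x : ℝ)) / (Fintype.card (↥T ⊕ ↥(chords G T)) : ℝ)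

/-- The degree-mass function of `T`: the proportion of the chords whose node has degree `d`. -/
def degreeMass (G : SimpleGraph V) (T : Finset (Sym2 V)) (d : ℕ) : ℝ :=
  ((Finset.univ.filter fun c : ↥(chords G T) => nodeDegree G T (Sum.inr c) = d).card : ℝ) /
    ((chords G T).card : ℝ)

/-- The set of ordered pairs of chords that have a common neighbor among the branches. -/
def sharingPairs (G : SimpleGraph V) (T : Finset (Sym2 V)) :
    Finset (↥(chords G T) × ↥(chords G T)) :=
  open scoped Classical in
  Finset.univ.filter fun q => ∃ b : ↥T,
    (bipartiteGraph G T).Adj (Sum.inr q.1) (Sum.inl b) ∧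
      (bipartiteGraph G T).Adj (Sum.inr q.2) (Sum.inl b)

end Graph

/-- The `n`-by-`n` square grid graph. -/
def grid (n : ℕ) : SimpleGraph (Fin n × Fin n) :=
  SimpleGraph.boxProd (SimpleGraph.pathGraph n) (SimpleGraph.pathGraph n)

/-- A family of spanning trees of the grids `grid n`, for `n` in an infinite set of indices
(for example all `n ≥ 1`). The value of `tree` outside the index set is irrelevant. -/
structure TreeFamily where
  index : Set ℕ
  index_infinite : index.Infinite
  tree : (n : ℕ) → Finset (Sym2 (Fin n × Fin n))
  isSpanningTree : ∀ n ∈ index, IsSpanningTree (grid n) (tree n)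

namespace TreeFamily

/-- The filter describing `n → ∞` within the index set of the family. -/
def toInfinity (F : TreeFamily) : Filter ℕ := atTop ⊓ 𝓟 F.index

/-- The minimal spanning tree probability of the `n`-th tree. -/
def prob (F : TreeFamily) (n : ℕ) : ℝ := probMST (grid n) (F.tree n)

/-- The average degree in the associated bipartite graph is `o(n²)`. -/
def IsBounded (F : TreeFamily) : Prop :=
  Tendsto (fun n : ℕ => averageDegree (grid n) (F.tree n) / (n : ℝ) ^ 2) F.toInfinity (𝓝 0)

/-- The family is convergent, with limiting degree-mass function `p`. -/
def ConvergesTo (F : TreeFamily) (p : ℕ → ℝ) : Prop :=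
  ∀ d : ℕ, Tendsto (fun n : ℕ => degreeMass (grid n) (F.tree n) d) F.toInfinity (𝓝 (p d))

/-- The proportion of the pairs of chords that have a common neighbor tends to zero. -/
def IsNeighborIndependent (F : TreeFamily) : Prop :=
  Tendsto (fun n : ℕ => ((sharingPairs (grid n) (F.tree n)).card : ℝ) /
      ((chords (grid n) (F.tree n)).card : ℝ) ^ 2) F.toInfinity (𝓝 0)

/-- The lower decay base, `liminf` of `Prob(T_n) ^ (1 / n²)`. The sequence takes values in
`[0, 1]`, so this real `liminf` is a genuine one. -/
def lowerDecayBase (F : TreeFamily) : ℝ :=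
  liminf (fun n : ℕ => F.prob n ^ (1 / (n : ℝ) ^ 2)) F.toInfinity

end TreeFamily

/-- The power series `1 + x - ∑_{d ≥ 3} p(d) (1 - x)^d`. -/
def powerSeries (p : ℕ → ℝ) (x : ℝ) : ℝ :=
  1 + x - ∑' k : ℕ, p (k + 3) * (1 - x) ^ (k + 3)

/-- The geometric mean of a function on `[0, 1]`. -/
def geometricMean (f : ℝ → ℝ) : ℝ :=
  Real.exp (∫ x in (0 : ℝ)..1, Real.log (f x))

end GridMST

end

/-!
Fix a spanning tree `T` with `N` branches. Once all branches on the cycle of a chord have been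
added, the chord is harmless: it will be rejected whenever it is selected, and selecting it does not
change the forest. Hence only the harmful edges compete for each effective step of the greedy
algorithm, and `T` is produced if a branch of `T` wins each time. If `u A` denotes the number of
harmful edges when the forest is `A ⊆ T`, the probability of `T` is thus at least the sum, over all
orders of the branches, of `∏ 1 / u A`, the product being over the proper initial segments `A` of
the order (`insertionWeight_le_probMST`).

By concavity of the logarithm this sum is at least `N! ∏_{i < N} 1 / ū i`, where `ū i` is the average
of `u A` over all `i`-element subsets `A` of `T` (`log_insertionWeight_ge`). A random `i`-element
subset contains the `d` branches on the cycle of a chord with probability about `(i / N) ^ d`. So in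
units of `N`, at time `t = i / N`, the average `ū i` is asymptotically at most
`(1 - t) + (1 - ∑ p d * t ^ d) = f (1 - t)` (`eventually_harmProfile_le`), since the numbers of
branches and of chords of the grid are both asymptotic to `n ^ 2`. Together with `N! ≥ (N / e) ^ N`
and dominated convergence for `∫ log f` (`tendsto_integral_log_max`), this gives the bound
`1 / (e f̄)` for the limit inferior of the `n ^ 2`-th roots.
-/


/-! ### Random insertion orders -/

/-- The total weight of all orders in which the elements of `T \ A` can be inserted, one at a time,
into `A`, where each insertion into a set `B` contributes a factor `1 / u B`. The numerical argument
counts the insertions and is meant to be `(T \ A).card`. -/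
noncomputable def insertionWeight {α : Type*} [DecidableEq α] (T : Finset α)
    (u : Finset α → ℝ) : ℕ → Finset α → ℝ
  | 0, _ => 1
  | r + 1, A => (∑ b ∈ T \ A, insertionWeight T u r (insert b A)) / u A

section Insertion

variable {α : Type*} [DecidableEq α] {T : Finset α} {u : Finset α → ℝ}

lemma sum_log_le_card_mul_log {ι : Type*} (s : Finset ι) (f : ι → ℝ) (hf : ∀ i ∈ s, 0 < f i) :
    ∑ i ∈ s, Real.log (f i) ≤ s.card * Real.log ((∑ i ∈ s, f i) / s.card) := by
  rcases s.eq_empty_or_nonempty with rfl | hs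
  · simp
  have hc : (0 : ℝ) < s.card := by exact_mod_cast hs.card_pos
  have h := strictConcaveOn_log_Ioi.concaveOn.le_map_sum (t := s) (w := fun _ => (s.card : ℝ)⁻¹)
    (p := f) (fun _ _ => by positivity) (by simp [hc.ne']) hf
  simp only [smul_eq_mul, ← Finset.mul_sum] at h
  rw [inv_mul_le_iff₀ hc] at h
  rwa [div_eq_inv_mul]

lemma insertionWeight_pos (hu : ∀ A, A ⊂ T → 0 < u A) (r : ℕ) :
    ∀ A ⊆ T, (T \ A).card = r → 0 < insertionWeight T u r A := by
  induction r with
  | zero => intro A _ _; simp [insertionWeight]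
  | succ r ih =>
    intro A hA hr
    have hne : (T \ A).Nonempty := by rw [← Finset.card_pos]; omega
    obtain ⟨b, hb⟩ := hne
    have hb' := Finset.mem_sdiff.1 hb
    refine div_pos (Finset.sum_pos (fun b hb => ?_) ⟨b, hb⟩)
      (hu A (Finset.ssubset_iff_subset_ne.2 ⟨hA, fun h => hb'.2 (h ▸ hb'.1)⟩))
    have hb := Finset.mem_sdiff.1 hb
    refine ih _ (Finset.insert_subset hb.1 hA) ?_
    rw [Finset.sdiff_insert, Finset.card_erase_of_mem (Finset.mem_sdiff.2 hb), hr]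
    simp

lemma log_insertionWeight_succ_ge (hu : ∀ A, A ⊂ T → 0 < u A) (r : ℕ) {A : Finset α} (hA : A ⊆ T)
    (hr : (T \ A).card = r + 1) :
    Real.log (r + 1 : ℝ) - Real.log (u A) +
        (∑ b ∈ T \ A, Real.log (insertionWeight T u r (insert b A))) / (r + 1 : ℝ) ≤
      Real.log (insertionWeight T u (r + 1) A) := by
  have hne : (T \ A).Nonempty := by rw [← Finset.card_pos]; omega
  have hpos : ∀ b ∈ T \ A, 0 < insertionWeight T u r (insert b A) := by
    intro b hb
    have hb' := Finset.mem_sdiff.1 hb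
    refine insertionWeight_pos hu r _ (Finset.insert_subset hb'.1 hA) ?_
    rw [Finset.sdiff_insert, Finset.card_erase_of_mem hb, hr]
    simp
  have hS := Finset.sum_pos hpos hne
  have huA : 0 < u A := by
    obtain ⟨b, hb⟩ := hne
    have hb := Finset.mem_sdiff.1 hb
    exact hu A (Finset.ssubset_iff_subset_ne.2 ⟨hA, fun h => hb.2 (h ▸ hb.1)⟩)
  have hj := sum_log_le_card_mul_log _ _ hpos
  have hr' : ((T \ A).card : ℝ) = r + 1 := by exact_mod_cast hr
  have hr0 : (0 : ℝ) < r + 1 := by positivity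
  rw [hr', Real.log_div hS.ne' hr0.ne'] at hj
  rw [insertionWeight, Real.log_div hS.ne' huA.ne']
  have := (div_le_iff₀' hr0).2 hj
  linarith

/-- Double counting of the pairs consisting of a set of size `i + 1` and one of its elements. -/
lemma sum_powersetCard_sum_insert (T : Finset α) (i : ℕ) (h : Finset α → ℝ) :
    ∑ A ∈ T.powersetCard i, ∑ b ∈ T \ A, h (insert b A) =
      (i + 1 : ℝ) * ∑ B ∈ T.powersetCard (i + 1), h B := by
  have : (i + 1 : ℝ) * ∑ B ∈ T.powersetCard (i + 1), h B =
      ∑ B ∈ T.powersetCard (i + 1), ∑ _b ∈ B, h B := by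
    rw [Finset.mul_sum]
    refine Finset.sum_congr rfl fun B hB => ?_
    simp [(Finset.mem_powersetCard.1 hB).2]
  rw [this, Finset.sum_sigma', Finset.sum_sigma']
  refine Finset.sum_bij' (fun x _ => ⟨insert x.2 x.1, x.2⟩) (fun x _ => ⟨x.1.erase x.2, x.2⟩)
    ?_ ?_ ?_ ?_ ?_
  · rintro ⟨A, b⟩ hx
    simp only [Finset.mem_sigma, Finset.mem_powersetCard, Finset.mem_sdiff] at hx ⊢
    obtain ⟨⟨hA, hc⟩, hb, hbA⟩ := hx
    exact ⟨⟨Finset.insert_subset hb hA, by rw [Finset.card_insert_of_notMem hbA, hc]⟩,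
      Finset.mem_insert_self _ _⟩
  · rintro ⟨B, b⟩ hx
    simp only [Finset.mem_sigma, Finset.mem_powersetCard, Finset.mem_sdiff] at hx ⊢
    obtain ⟨⟨hB, hc⟩, hb⟩ := hx
    exact ⟨⟨(Finset.erase_subset _ _).trans hB, by rw [Finset.card_erase_of_mem hb, hc]; simp⟩,
      hB hb, Finset.notMem_erase _ _⟩
  · rintro ⟨A, b⟩ hx
    simp only [Finset.mem_sigma, Finset.mem_sdiff] at hx
    simp [Finset.erase_insert hx.2.2]
  · rintro ⟨B, b⟩ hx
    simp only [Finset.mem_sigma] at hx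
    simp [Finset.insert_erase hx.2]
  · rintro ⟨A, b⟩ _
    rfl

/-- Concavity of the logarithm, used once over the next element to be inserted and once over the
current set, bounds the weight of all insertion orders from below by the averages of the costs over
the subsets of each size. -/
lemma log_insertionWeight_ge (hu : ∀ A, A ⊂ T → 0 < u A) :
    Real.log (T.card.factorial) -
        ∑ i ∈ Finset.range T.card,
          Real.log ((∑ A ∈ T.powersetCard i, u A) / (T.card.choose i : ℝ)) ≤
      Real.log (insertionWeight T u T.card ∅) := by
  set N := T.card with hN
  set M : ℕ → ℝ := fun i =>
    (∑ A ∈ T.powersetCard i, Real.log (insertionWeight T u (N - i) A)) / (N.choose i : ℝ) with hM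
  have step : ∀ i < N, Real.log ((N - i : ℕ) : ℝ) -
      Real.log ((∑ A ∈ T.powersetCard i, u A) / (N.choose i : ℝ)) + M (i + 1) ≤ M i := by
    intro i hi
    obtain ⟨r, hr⟩ : ∃ r, N - i = r + 1 := ⟨N - i - 1, by omega⟩
    have hr' : N - (i + 1) = r := by omega
    have hC : (0 : ℝ) < N.choose i := by exact_mod_cast Nat.choose_pos hi.le
    have hC' : (0 : ℝ) < N.choose (i + 1) := by exact_mod_cast Nat.choose_pos hi
    have hr0 : (0 : ℝ) < r + 1 := by positivity
    have hcard : (T.powersetCard i).card = N.choose i := Finset.card_powersetCard _ _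
    have h1 := Finset.sum_le_sum (s := T.powersetCard i) fun A hA =>
      log_insertionWeight_succ_ge hu r (Finset.mem_powersetCard.1 hA).1
        (by rw [Finset.card_sdiff_of_subset (Finset.mem_powersetCard.1 hA).1,
              (Finset.mem_powersetCard.1 hA).2]; omega)
    rw [Finset.sum_add_distrib, Finset.sum_sub_distrib, Finset.sum_const, ← Finset.sum_div,
      sum_powersetCard_sum_insert T i fun B => Real.log (insertionWeight T u r B), hcard,
      nsmul_eq_mul] at h1
    have h2 := sum_log_le_card_mul_log (T.powersetCard i) u fun A hA => by
      refine hu A (Finset.ssubset_iff_subset_ne.2 ⟨(Finset.mem_powersetCard.1 hA).1, fun h => ?_⟩)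
      have := (Finset.mem_powersetCard.1 hA).2
      rw [h] at this
      omega
    rw [hcard] at h2
    have h3 : (i + 1 : ℝ) / (r + 1) = N.choose i / N.choose (i + 1) := by
      have := Nat.choose_succ_right_eq N i
      rw [hr] at this
      rw [div_eq_div_iff hr0.ne' hC'.ne']
      have h : (N.choose (i + 1) : ℝ) * (i + 1) = N.choose i * (r + 1) := by exact_mod_cast this
      linarith
    have h4 : (i + 1 : ℝ) * (∑ B ∈ T.powersetCard (i + 1), Real.log (insertionWeight T u r B)) /
        (r + 1) = N.choose i * M (i + 1) := by
      rw [mul_div_right_comm, h3, hM]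
      simp only [hr']
      field_simp
    rw [h4] at h1
    have h5 : (N.choose i : ℝ) * M i =
        ∑ A ∈ T.powersetCard i, Real.log (insertionWeight T u (r + 1) A) := by
      rw [hM]
      simp only [hr]
      field_simp
    rw [← h5] at h1
    rw [hr]
    push_cast
    refine le_of_mul_le_mul_left ?_ hC
    linarith
  have main : ∀ k ≤ N, ∑ i ∈ Finset.range k, (Real.log ((N - i : ℕ) : ℝ) -
      Real.log ((∑ A ∈ T.powersetCard i, u A) / (N.choose i : ℝ))) + M k ≤ M 0 := by
    intro k
    induction k with
    | zero => simp
    | succ k ih =>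
      intro hk
      rw [Finset.sum_range_succ]
      have := ih (by omega)
      have := step k (by omega)
      linarith
  have h0 : M 0 = Real.log (insertionWeight T u N ∅) := by simp [hM]
  have hNN : M N = 0 := by simp [hM, insertionWeight]
  have := main N le_rfl
  rw [h0, hNN, Finset.sum_sub_distrib, add_zero] at this
  have hfac : Real.log (N.factorial) = ∑ i ∈ Finset.range N, Real.log ((N - i : ℕ) : ℝ) := by
    rw [← Nat.descFactorial_self, Nat.descFactorial_eq_prod_range, Nat.cast_prod, Real.log_prod]
    intro i hi
    have := Finset.mem_range.1 hi
    exact_mod_cast (by omega : N - i ≠ 0)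
  rw [hfac]
  exact this

/-- An `i`-element subset of `T` contains a given `d`-element subset with probability
`i (i - 1) ⋯ / (N (N - 1) ⋯)`, which is at least `((i + 1 - d) / N) ^ d`. -/
lemma pow_mul_choose_le_card_filter_subset {S : Finset α} (hS : S ⊆ T) {i : ℕ} (hi : i ≤ T.card) :
    (((i + 1 - S.card : ℕ) : ℝ) / T.card) ^ S.card * (T.card.choose i : ℝ) ≤
      ((T.powersetCard i).filter (S ⊆ ·)).card := by
  set d := S.card with hd
  set N := T.card with hN
  have hdN : d ≤ N := Finset.card_le_card hS
  rcases Nat.lt_or_ge i d with h | h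
  · have : i + 1 - d = 0 := by omega
    rw [this]
    have hd0 : d ≠ 0 := by omega
    simp [hd0]
  rw [Finset.card_filter_powersetCard_subset S T i hS h]
  rcases Nat.eq_zero_or_pos N with h0 | hN0
  · have : d = 0 := by omega
    simp [this, h0, ← hN, ← hd]
  have key : (i + 1 - d) ^ d * N.choose i ≤ N ^ d * (N - d).choose (i - d) := by
    have h1 := Nat.choose_mul (n := N) h
    have h2 : N.choose i * i.descFactorial d = N.descFactorial d * (N - d).choose (i - d) := by
      rw [Nat.descFactorial_eq_factorial_mul_choose, Nat.descFactorial_eq_factorial_mul_choose,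
        mul_left_comm, h1, mul_assoc]
    calc (i + 1 - d) ^ d * N.choose i ≤ i.descFactorial d * N.choose i :=
          Nat.mul_le_mul_right _ (Nat.pow_sub_le_descFactorial i d)
      _ = N.descFactorial d * (N - d).choose (i - d) := by rw [mul_comm, h2]
      _ ≤ _ := Nat.mul_le_mul_right _ (Nat.descFactorial_le_pow N d)
  rw [div_pow, div_mul_eq_mul_div, div_le_iff₀ (by positivity), mul_comm (((N - d).choose _ : ℕ) : ℝ)]
  exact_mod_cast key

end Insertion


namespace GridMST

/-! ### The greedy algorithm and its harmless edges -/

section Greedy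

variable {V : Type*} [Fintype V] [DecidableEq V]

open scoped Classical in
/-- The neighbors of the chord `c` in the bipartite graph of `T`: the branches on its cycle. -/
noncomputable def cycleBranches (T : Finset (Sym2 V)) (c : Sym2 V) : Finset (Sym2 V) :=
  T.filter (· ∈ cycle T c)

/-- The number of edges of `G` outside the subforest `A` of `T` that are not harmless, when a chord
is called harmless as soon as all branches on its cycle belong to `A` (it is rejected from then on,
so selecting it does not matter). -/
noncomputable def harmfulCount (G : SimpleGraph V) (T A : Finset (Sym2 V)) : ℝ :=
  (T \ A).card + ((chords G T).filter fun c => ¬ cycleBranches T c ⊆ A).card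

omit [Fintype V] in
lemma mem_cycleBranches {T : Finset (Sym2 V)} {b c : Sym2 V} :
    b ∈ cycleBranches T c ↔ b ∈ T ∧ b ∈ cycle T c := by
  classical exact Finset.mem_filter

omit [Fintype V] in
lemma cycleBranches_subset (T : Finset (Sym2 V)) (c : Sym2 V) : cycleBranches T c ⊆ T :=
  fun _ hb => (mem_cycleBranches.1 hb).1

lemma nodeDegree_inr (G : SimpleGraph V) (T : Finset (Sym2 V)) (c : ↥(chords G T)) :
    nodeDegree G T (Sum.inr c) = (cycleBranches T c).card := by
  classical
  unfold nodeDegree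
  rw [← SimpleGraph.card_neighborFinset_eq_degree]
  symm
  refine Finset.card_bij (fun b hb => Sum.inl ⟨b, cycleBranches_subset T c hb⟩) ?_ ?_ ?_
  · intro b hb
    have := (mem_cycleBranches.1 hb).2
    rw [SimpleGraph.mem_neighborFinset, bipartiteGraph, SimpleGraph.fromRel_adj]
    exact ⟨by simp, Or.inr ⟨⟨b, cycleBranches_subset T c hb⟩, c, rfl, rfl, this⟩⟩
  · intro a ha b hb h
    simpa using h
  · intro x hx
    rw [SimpleGraph.mem_neighborFinset, bipartiteGraph, SimpleGraph.fromRel_adj] at hx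
    rcases hx.2 with ⟨b, c', h, -⟩ | ⟨b, c', h, h', hb⟩
    · simp at h
    · refine ⟨b, ?_, h.symm⟩
      obtain rfl := Sum.inr_injective h'
      exact mem_cycleBranches.2 ⟨b.2, hb⟩

omit [DecidableEq V] in
lemma mem_edges {G : SimpleGraph V} {e : Sym2 V} : e ∈ edges G ↔ e ∈ G.edgeSet := by
  simp [edges]

lemma not_isAcyclic_insert_chord {G : SimpleGraph V} {T : Finset (Sym2 V)}
    (hT : IsSpanningTree G T) {c : Sym2 V} (hc : c ∈ chords G T) :
    ¬ (SimpleGraph.fromEdgeSet ((insert c T : Finset (Sym2 V)) : Set (Sym2 V))).IsAcyclic := by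
  intro h
  have hc := Finset.mem_sdiff.1 hc
  have hle : SimpleGraph.fromEdgeSet (T : Set (Sym2 V)) ≤
      SimpleGraph.fromEdgeSet ((insert c T : Finset (Sym2 V)) : Set (Sym2 V)) :=
    SimpleGraph.fromEdgeSet_mono (by simp)
  have hmax := (SimpleGraph.isTree_iff_maximal_isAcyclic.1 hT.2).2.2 h hle
  have hd : ¬ c.IsDiag := G.not_isDiag_of_mem_edgeSet (mem_edges.1 hc.1)
  have : c ∈ (SimpleGraph.fromEdgeSet (T : Set (Sym2 V))).edgeSet :=
    SimpleGraph.edgeSet_mono hmax (by simp [SimpleGraph.edgeSet_fromEdgeSet, hd])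
  rw [SimpleGraph.edgeSet_fromEdgeSet] at this
  exact hc.2 (by simpa using this.1)

/-- The cycle that `c` closes in `T` is already contained in `A` together with `c`. -/
lemma addEdge_of_cycleBranches_subset {G : SimpleGraph V} {T A : Finset (Sym2 V)}
    (hT : IsSpanningTree G T) {c : Sym2 V} (hc : c ∈ chords G T) (h : cycleBranches T c ⊆ A) :
    addEdge A c = A := by
  unfold addEdge
  rw [if_neg]
  intro hacyc
  refine not_isAcyclic_insert_chord hT hc fun v w hw => ?_
  have hmem : ∀ e ∈ w.edges,
      e ∈ (SimpleGraph.fromEdgeSet ((insert c A : Finset (Sym2 V)) : Set (Sym2 V))).edgeSet := by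
    intro e he
    have he' := w.edges_subset_edgeSet he
    rw [SimpleGraph.edgeSet_fromEdgeSet] at he' ⊢
    refine ⟨?_, he'.2⟩
    have h1 := he'.1
    simp only [Finset.mem_coe, Finset.mem_insert] at h1 ⊢
    rcases h1 with h1 | h1
    · exact Or.inl h1
    · exact Or.inr (h (mem_cycleBranches.2 ⟨h1, v, w, hw, he⟩))
  exact hacyc _ (hw.transfer hmem)

omit [Fintype V] in
lemma addEdge_of_insert_subset {G : SimpleGraph V} {T A : Finset (Sym2 V)}
    (hT : IsSpanningTree G T) {b : Sym2 V} (h : insert b A ⊆ T) : addEdge A b = insert b A := by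
  unfold addEdge
  rw [if_pos]
  exact hT.2.isAcyclic.anti (SimpleGraph.fromEdgeSet_mono (by exact_mod_cast h))

lemma greedy_succ_apply_toReal (k : ℕ) (A R T : Finset (Sym2 V)) (hR : R.Nonempty) :
    (greedy (k + 1) A R T).toReal =
      (∑ e ∈ R, (greedy k (addEdge A e) (R.erase e) T).toReal) / R.card := by
  classical
  rw [greedy, dif_pos hR, PMF.bind_apply, tsum_fintype, ENNReal.toReal_sum, Finset.sum_div,
    ← Finset.sum_subset (Finset.subset_univ R)]
  · refine Finset.sum_congr rfl fun e he => ?_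
    rw [PMF.uniformOfFinset_apply_of_mem _ he, ENNReal.toReal_mul, ENNReal.toReal_inv,
      ENNReal.toReal_natCast]
    rw [div_eq_inv_mul]
  · intro e _ he
    rw [PMF.uniformOfFinset_apply_of_notMem _ he]
    simp
  · intro e _
    exact ENNReal.mul_ne_top (PMF.apply_ne_top _ _) (PMF.apply_ne_top _ _)

lemma harmfulCount_pos (G : SimpleGraph V) {T A : Finset (Sym2 V)} (hA : A ⊂ T) :
    0 < harmfulCount G T A := by
  have : 0 < (T \ A).card := Finset.card_pos.2 (Finset.sdiff_nonempty.2 hA.2)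
  unfold harmfulCount
  positivity

/-- The defining recursion, in a form that also holds for `A = T`, where both sides vanish. -/
lemma harmfulCount_mul_insertionWeight (G : SimpleGraph V) {T A : Finset (Sym2 V)} (hA : A ⊆ T) :
    harmfulCount G T A * insertionWeight T (harmfulCount G T) (T \ A).card A =
      ∑ b ∈ T \ A, insertionWeight T (harmfulCount G T) (T \ insert b A).card (insert b A) := by
  rcases hA.eq_or_ssubset with rfl | hA'
  · simp only [sdiff_self, Finset.bot_eq_empty, Finset.sum_empty, mul_eq_zero]
    left
    simp [harmfulCount, cycleBranches_subset]
  · have hpos := harmfulCount_pos G hA'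
    obtain ⟨r, hr⟩ : ∃ r, (T \ A).card = r + 1 :=
      Nat.exists_eq_add_one.2 (Finset.card_pos.2 (Finset.sdiff_nonempty.2 hA'.2))
    rw [hr, insertionWeight, mul_div_cancel₀ _ hpos.ne']
    refine Finset.sum_congr rfl fun b hb => ?_
    rw [Finset.sdiff_insert, Finset.card_erase_of_mem hb, hr]
    simp

/-- Harmless chords do not change the state of the greedy algorithm, so only the harmful edges
compete for the next step, and `T` is produced if the branches win all of these competitions. -/
lemma insertionWeight_le_greedy {G : SimpleGraph V} {T : Finset (Sym2 V)}
    (hT : IsSpanningTree G T) (k : ℕ) :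
    ∀ A R : Finset (Sym2 V), A ⊆ T → R ⊆ edges G → T \ A ⊆ R → Disjoint A R → R.card = k →
      insertionWeight T (harmfulCount G T) (T \ A).card A ≤ (greedy k A R T).toReal := by
  induction k with
  | zero =>
    intro A R hA _ hTR _ hk
    obtain rfl := Finset.card_eq_zero.1 hk
    have h0 : T \ A = ∅ := Finset.subset_empty.1 hTR
    obtain rfl : A = T := hA.antisymm (Finset.sdiff_eq_empty_iff_subset.1 h0)
    simp [greedy, insertionWeight]
  | succ k ih =>
    intro A R hA hRG hTR hAR hk
    have hR : R.Nonempty := Finset.card_pos.1 (by omega)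
    have hRpos : (0 : ℝ) < R.card := by exact_mod_cast hR.card_pos
    rw [greedy_succ_apply_toReal k A R T hR, le_div_iff₀ hRpos]
    set Φ := insertionWeight T (harmfulCount G T) (T \ A).card A with hΦ
    have hΦ0 : 0 < Φ := insertionWeight_pos (fun _ h => harmfulCount_pos G h) _ A hA rfl
    set H := (R \ T).filter fun c => cycleBranches T c ⊆ A with hH
    have hchord : ∀ c ∈ R \ T, c ∈ chords G T := fun c hc =>
      Finset.mem_sdiff.2 ⟨hRG (Finset.mem_sdiff.1 hc).1, (Finset.mem_sdiff.1 hc).2⟩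
    have hdisj : Disjoint (T \ A) H := by
      rw [Finset.disjoint_left]
      intro b hb hb'
      exact (Finset.mem_sdiff.1 (Finset.mem_filter.1 hb').1).2 (Finset.mem_sdiff.1 hb).1
    have hsub : (T \ A) ∪ H ⊆ R :=
      Finset.union_subset hTR ((Finset.filter_subset _ _).trans Finset.sdiff_subset)
    have hbranch : ∀ b ∈ T \ A,
        insertionWeight T (harmfulCount G T) (T \ insert b A).card (insert b A) ≤
          (greedy k (addEdge A b) (R.erase b) T).toReal := by
      intro b hb
      have hb' := Finset.mem_sdiff.1 hb
      have hins : insert b A ⊆ T := Finset.insert_subset hb'.1 hA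
      rw [addEdge_of_insert_subset hT hins]
      refine ih _ _ hins ((Finset.erase_subset _ _).trans hRG) ?_ ?_ ?_
      · rw [Finset.sdiff_insert]
        exact Finset.erase_subset_erase _ hTR
      · rw [Finset.disjoint_insert_left]
        exact ⟨Finset.notMem_erase _ _, hAR.mono_right (Finset.erase_subset _ _)⟩
      · rw [Finset.card_erase_of_mem (hTR hb), hk]
        simp
    have hharmless : ∀ c ∈ H, Φ ≤ (greedy k (addEdge A c) (R.erase c) T).toReal := by
      intro c hc
      have hc' := Finset.mem_filter.1 hc
      have hcR := Finset.mem_sdiff.1 hc'.1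
      rw [addEdge_of_cycleBranches_subset hT (hchord c hc'.1) hc'.2]
      refine ih _ _ hA ((Finset.erase_subset _ _).trans hRG) ?_
        (hAR.mono_right (Finset.erase_subset _ _)) ?_
      · intro b hb
        refine Finset.mem_erase.2 ⟨?_, hTR hb⟩
        rintro rfl
        exact hcR.2 (Finset.mem_sdiff.1 hb).1
      · rw [Finset.card_erase_of_mem hcR.1, hk]
        simp
    have hcount : (R.card : ℝ) ≤ harmfulCount G T A + H.card := by
      have h1 : R ⊆ ((T \ A) ∪ (chords G T).filter fun c => ¬ cycleBranches T c ⊆ A) ∪ H := by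
        intro e he
        have heA : e ∉ A := fun h => Finset.disjoint_left.1 hAR h he
        by_cases heT : e ∈ T
        · simp [heT, heA]
        · have hce := hchord e (Finset.mem_sdiff.2 ⟨he, heT⟩)
          by_cases hcl : cycleBranches T e ⊆ A
          · exact Finset.mem_union_right _
              (Finset.mem_filter.2 ⟨Finset.mem_sdiff.2 ⟨he, heT⟩, hcl⟩)
          · exact Finset.mem_union_left _
              (Finset.mem_union_right _ (Finset.mem_filter.2 ⟨hce, hcl⟩))
      have h2 := (Finset.card_le_card h1).trans ((Finset.card_union_le _ _).trans
        (Nat.add_le_add_right (Finset.card_union_le _ _) _))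
      unfold harmfulCount
      exact_mod_cast h2
    calc Φ * R.card ≤ Φ * (harmfulCount G T A + H.card) := by gcongr
      _ = ∑ b ∈ T \ A, insertionWeight T (harmfulCount G T) (T \ insert b A).card (insert b A) +
            ∑ _c ∈ H, Φ := by
          rw [← harmfulCount_mul_insertionWeight G hA, Finset.sum_const, nsmul_eq_mul]
          ring
      _ ≤ ∑ e ∈ T \ A, (greedy k (addEdge A e) (R.erase e) T).toReal +
            ∑ e ∈ H, (greedy k (addEdge A e) (R.erase e) T).toReal :=
          add_le_add (Finset.sum_le_sum hbranch) (Finset.sum_le_sum hharmless)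
      _ = ∑ e ∈ (T \ A) ∪ H, (greedy k (addEdge A e) (R.erase e) T).toReal :=
          (Finset.sum_union hdisj).symm
      _ ≤ _ := Finset.sum_le_sum_of_subset_of_nonneg hsub fun _ _ _ => ENNReal.toReal_nonneg

lemma insertionWeight_le_probMST {G : SimpleGraph V} {T : Finset (Sym2 V)}
    (hT : IsSpanningTree G T) :
    insertionWeight T (harmfulCount G T) T.card ∅ ≤ probMST G T := by
  have h := insertionWeight_le_greedy hT (edges G).card ∅ (edges G) (Finset.empty_subset _)
    subset_rfl (fun b hb => mem_edges.2 (hT.1 (by simpa using hb))) (by simp) rfl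
  simpa [probMST, mstDistribution] using h

/-- An upper bound for the average of `harmfulCount` over the `i`-element subsets of `T`. The
truncated subtraction makes the contribution of a chord with `d > i` branches on its cycle equal
to `1`, as it should be. -/
noncomputable def averageHarmBound (G : SimpleGraph V) (T : Finset (Sym2 V)) (i : ℕ) : ℝ :=
  ((T.card : ℝ) - i) + ∑ c ∈ chords G T,
    (1 - (((i + 1 - (cycleBranches T c).card : ℕ) : ℝ) / T.card) ^ (cycleBranches T c).card)

lemma average_harmfulCount_le (G : SimpleGraph V) (T : Finset (Sym2 V)) {i : ℕ} (hi : i ≤ T.card) :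
    (∑ A ∈ T.powersetCard i, harmfulCount G T A) / (T.card.choose i : ℝ) ≤
      averageHarmBound G T i := by
  have hC : (0 : ℝ) < T.card.choose i := by exact_mod_cast Nat.choose_pos hi
  rw [div_le_iff₀ hC]
  unfold harmfulCount averageHarmBound
  rw [Finset.sum_add_distrib, add_mul]
  refine add_le_add (le_of_eq ?_) ?_
  · rw [Finset.sum_congr rfl (g := fun _ => (T.card : ℝ) - i), Finset.sum_const,
      Finset.card_powersetCard, nsmul_eq_mul, mul_comm]
    intro A hA
    have := Finset.mem_powersetCard.1 hA
    rw [Finset.card_sdiff_of_subset this.1, this.2, Nat.cast_sub hi]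
  · simp only [Finset.card_filter, Nat.cast_sum]
    rw [Finset.sum_comm, Finset.sum_mul]
    refine Finset.sum_le_sum fun c _ => ?_
    have h := pow_mul_choose_le_card_filter_subset (cycleBranches_subset T c) hi
    have h2 : ∑ A ∈ T.powersetCard i, (((if ¬ cycleBranches T c ⊆ A then 1 else 0 : ℕ)) : ℝ) =
        T.card.choose i - ((T.powersetCard i).filter (cycleBranches T c ⊆ ·)).card := by
      rw [← Nat.cast_sum, ← Finset.card_filter, eq_sub_iff_add_eq', ← Nat.cast_add,
        Finset.card_filter_add_card_filter_not, Finset.card_powersetCard]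
    rw [h2]
    linarith

lemma log_probMST_ge {G : SimpleGraph V} {T : Finset (Sym2 V)} (hT : IsSpanningTree G T) :
    0 < probMST G T ∧
      Real.log (T.card.factorial) - ∑ i ∈ Finset.range T.card, Real.log (averageHarmBound G T i) ≤
        Real.log (probMST G T) := by
  have hu : ∀ A, A ⊂ T → 0 < harmfulCount G T A := fun A h => harmfulCount_pos G h
  have hpos : 0 < insertionWeight T (harmfulCount G T) T.card ∅ :=
    insertionWeight_pos hu _ ∅ (Finset.empty_subset _) (by simp)
  have hle := insertionWeight_le_probMST hT
  refine ⟨hpos.trans_le hle, ?_⟩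
  have h1 := log_insertionWeight_ge hu
  have h2 := Real.log_le_log hpos hle
  have h3 : ∑ i ∈ Finset.range T.card,
        Real.log ((∑ A ∈ T.powersetCard i, harmfulCount G T A) / (T.card.choose i : ℝ)) ≤
      ∑ i ∈ Finset.range T.card, Real.log (averageHarmBound G T i) := by
    refine Finset.sum_le_sum fun i hi => ?_
    have hi := Finset.mem_range.1 hi
    refine Real.log_le_log (div_pos (Finset.sum_pos (fun A hA => hu A ?_) ?_) ?_)
      (average_harmfulCount_le G T hi.le)
    · have := Finset.mem_powersetCard.1 hA
      refine Finset.ssubset_iff_subset_ne.2 ⟨this.1, fun h => ?_⟩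
      rw [h] at this
      omega
    · exact Finset.powersetCard_nonempty.2 hi.le
    · exact_mod_cast Nat.choose_pos hi.le
  linarith

/-- Chords whose degree is not in `s` may be counted as harmful throughout, so that only the values
of the degree-mass function on the finite set `s` enter. -/
lemma averageHarmBound_le (G : SimpleGraph V) (T : Finset (Sym2 V)) (i : ℕ)
    (s : Finset ℕ) :
    averageHarmBound G T i ≤ ((T.card : ℝ) - i) + (chords G T).card *
      (1 - ∑ d ∈ s, degreeMass G T d * (((i + 1 - d : ℕ) : ℝ) / T.card) ^ d) := by
  unfold averageHarmBound
  rw [Finset.sum_sub_distrib, Finset.sum_const, nsmul_eq_mul, mul_one, mul_sub, mul_one]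
  have hcount : ∀ d, ((chords G T).card : ℝ) * degreeMass G T d =
      ((chords G T).filter fun c => (cycleBranches T c).card = d).card := by
    intro d
    have h1 : ((Finset.univ.filter fun c : ↥(chords G T) =>
        nodeDegree G T (Sum.inr c) = d).card) =
        ((chords G T).filter fun c => (cycleBranches T c).card = d).card := by
      simp only [nodeDegree_inr]
      rw [Finset.card_filter, Finset.card_filter,
        Finset.sum_coe_sort (chords G T) fun c => if (cycleBranches T c).card = d then 1 else 0]
    unfold degreeMass
    rw [h1]
    rcases (chords G T).eq_empty_or_nonempty with h | h
    · simp [h]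
    · have : ((chords G T).card : ℝ) ≠ 0 := by exact_mod_cast h.card_pos.ne'
      field_simp
  have key : ((chords G T).card : ℝ) *
      ∑ d ∈ s, degreeMass G T d * (((i + 1 - d : ℕ) : ℝ) / T.card) ^ d ≤
      ∑ c ∈ chords G T, (((i + 1 - (cycleBranches T c).card : ℕ) : ℝ) / T.card) ^
        (cycleBranches T c).card := by
    rw [Finset.mul_sum]
    calc _ = ∑ d ∈ s, ∑ c ∈ (chords G T).filter (fun c => (cycleBranches T c).card = d),
          (((i + 1 - (cycleBranches T c).card : ℕ) : ℝ) / T.card) ^ (cycleBranches T c).card := by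
          refine Finset.sum_congr rfl fun d _ => ?_
          rw [← mul_assoc, hcount, Finset.sum_congr rfl
            (g := fun _ => (((i + 1 - d : ℕ) : ℝ) / T.card) ^ d), Finset.sum_const, nsmul_eq_mul]
          intro c hc
          rw [(Finset.mem_filter.1 hc).2]
      _ = ∑ c ∈ (chords G T).filter (fun c => (cycleBranches T c).card ∈ s),
          (((i + 1 - (cycleBranches T c).card : ℕ) : ℝ) / T.card) ^ (cycleBranches T c).card := by
          rw [← Finset.sum_fiberwise_of_maps_to (t := s) (g := fun c => (cycleBranches T c).card)
            (s := (chords G T).filter (fun c => (cycleBranches T c).card ∈ s))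
            (fun c hc => (Finset.mem_filter.1 hc).2)]
          refine Finset.sum_congr rfl fun d hd => Finset.sum_congr ?_ fun _ _ => rfl
          ext c
          simp only [Finset.mem_filter]
          constructor
          · rintro ⟨h1, rfl⟩
            exact ⟨⟨h1, hd⟩, rfl⟩
          · rintro ⟨⟨h1, _⟩, h2⟩
            exact ⟨h1, h2⟩
      _ ≤ _ := Finset.sum_le_sum_of_subset_of_nonneg (Finset.filter_subset _ _)
          fun _ _ _ => by positivity
  linarith

lemma degreeMass_nonneg (G : SimpleGraph V) (T : Finset (Sym2 V)) (d : ℕ) :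
    0 ≤ degreeMass G T d := by
  unfold degreeMass
  positivity

lemma sum_degreeMass_le_one (G : SimpleGraph V) (T : Finset (Sym2 V)) (s : Finset ℕ) :
    ∑ d ∈ s, degreeMass G T d ≤ 1 := by
  unfold degreeMass
  rw [← Finset.sum_div]
  refine div_le_one_of_le₀ ?_ (by positivity)
  rw [← Nat.cast_sum, Nat.cast_le, ← Fintype.card_coe]
  rw [← Finset.card_biUnion]
  · exact Finset.card_le_univ _
  · intro a _ b _ hab
    rw [Function.onFun, Finset.disjoint_left]
    intro c hc hc'
    exact hab ((Finset.mem_filter.1 hc).2.symm.trans (Finset.mem_filter.1 hc').2)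

lemma averageHarmBound_bounds (G : SimpleGraph V) (T : Finset (Sym2 V)) {i : ℕ} (hi : i ≤ T.card) :
    (T.card : ℝ) - i ≤ averageHarmBound G T i ∧
      averageHarmBound G T i ≤ T.card + (chords G T).card := by
  constructor
  · unfold averageHarmBound
    refine le_add_of_nonneg_right (Finset.sum_nonneg fun c _ => ?_)
    rw [sub_nonneg]
    -- for `d = 0` the base `(i + 1) / N` may exceed `1`, but the power is `1`
    rcases Nat.eq_zero_or_pos (cycleBranches T c).card with h | h
    · simp [h]
    · refine pow_le_one₀ (by positivity) (div_le_one_of_le₀ ?_ (by positivity))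
      exact_mod_cast (by omega : i + 1 - (cycleBranches T c).card ≤ T.card)
  · have h := averageHarmBound_le G T i ∅
    have : (0 : ℝ) ≤ i := by positivity
    simp only [Finset.sum_empty, sub_zero, mul_one] at h
    linarith

lemma card_add_one_of_isSpanningTree {G : SimpleGraph V} {T : Finset (Sym2 V)}
    (hT : IsSpanningTree G T) : T.card + 1 = Fintype.card V := by
  classical
  rw [← hT.2.card_edgeFinset]
  congr 2
  ext e
  rw [SimpleGraph.mem_edgeFinset, SimpleGraph.edgeSet_fromEdgeSet]
  refine ⟨fun h => ⟨by simpa using h, ?_⟩, fun h => by simpa using h.1⟩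
  exact G.not_isDiag_of_mem_edgeSet (hT.1 (by simpa using h))

end Greedy

/-- Every edge of the grid joins some node to its right or upper neighbor. -/
lemma card_edges_grid_le (n : ℕ) : (edges (grid n)).card ≤ 2 * n ^ 2 := by
  classical
  have : edges (grid n) ⊆ (Finset.univ : Finset ((Fin n × Fin n) × Bool)).image fun x =>
      if x.2 then s(x.1, (⟨(x.1.1 + 1) % n, Nat.mod_lt _ x.1.1.pos⟩, x.1.2))
      else s(x.1, (x.1.1, ⟨(x.1.2 + 1) % n, Nat.mod_lt _ x.1.1.pos⟩)) := by
    have aux : ∀ a b : Fin n, a.val + 1 = b.val → ∀ h : (a.val + 1) % n < n,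
        (⟨(a.val + 1) % n, h⟩ : Fin n) = b := by
      intro a b hab h
      ext
      simp only [hab, Nat.mod_eq_of_lt b.2]
    intro e
    induction e using Sym2.ind with
    | _ x y =>
      intro he
      rw [mem_edges, SimpleGraph.mem_edgeSet, grid, SimpleGraph.boxProd_adj,
        SimpleGraph.pathGraph_adj, SimpleGraph.pathGraph_adj] at he
      rw [Finset.mem_image]
      obtain ⟨x1, x2⟩ := x
      obtain ⟨y1, y2⟩ := y
      simp only at he
      rcases he with ⟨h | h, rfl⟩ | ⟨h | h, rfl⟩
      · exact ⟨((x1, x2), true), Finset.mem_univ _, by simp [aux _ _ h]⟩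
      · exact ⟨((y1, x2), true), Finset.mem_univ _, by simp [aux _ _ h, Sym2.eq_swap]⟩
      · exact ⟨((x1, x2), false), Finset.mem_univ _, by simp [aux _ _ h]⟩
      · exact ⟨((x1, y2), false), Finset.mem_univ _, by simp [aux _ _ h, Sym2.eq_swap]⟩
  refine (Finset.card_le_card this).trans (Finset.card_image_le.trans ?_)
  simp [Fintype.card_prod]
  ring_nf
  rfl

lemma card_chords_grid_le {n : ℕ} {T : Finset (Sym2 (Fin n × Fin n))}
    (hT : IsSpanningTree (grid n) T) : (chords (grid n) T).card ≤ T.card + 2 := by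
  have h1 := card_add_one_of_isSpanningTree hT
  have h2 := card_edges_grid_le n
  have h3 : T ⊆ edges (grid n) := fun b hb => mem_edges.2 (hT.1 (by simpa using hb))
  rw [chords, Finset.card_sdiff_of_subset h3]
  simp only [Fintype.card_prod, Fintype.card_fin] at h1
  nlinarith [Nat.sub_le_iff_le_add.2 (show (edges (grid n)).card ≤ (T.card + 2) + T.card by nlinarith)]

end GridMST


namespace GridMST

/-! ### The limiting power series -/

section PowerSeries

variable {p : ℕ → ℝ}

lemma summable_shift_of_sum_le_one (h0 : ∀ d, 0 ≤ p d) (h1 : ∀ s : Finset ℕ, ∑ d ∈ s, p d ≤ 1) :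
    Summable (fun k => p (k + 3)) ∧ ∑' k, p (k + 3) ≤ 1 := by
  have h : ∀ s : Finset ℕ, ∑ k ∈ s, p (k + 3) ≤ 1 := fun s => by
    simpa using h1 (s.map (addRightEmbedding 3))
  have hs : Summable fun k => p (k + 3) := summable_of_sum_le (fun k => h0 _) h
  exact ⟨hs, hs.tsum_le_of_sum_le h⟩

lemma summable_powerSeries (h0 : ∀ d, 0 ≤ p d) (h1 : ∀ s : Finset ℕ, ∑ d ∈ s, p d ≤ 1) {x : ℝ}
    (hx : x ∈ Set.Icc (0 : ℝ) 1) : Summable fun k : ℕ => p (k + 3) * (1 - x) ^ (k + 3) := by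
  have hx0 : 0 ≤ 1 - x := by linarith [hx.2]
  refine (summable_shift_of_sum_le_one h0 h1).1.of_nonneg_of_le
    (fun k => mul_nonneg (h0 _) (by positivity)) fun k => ?_
  exact mul_le_of_le_one_right (h0 _) (pow_le_one₀ hx0 (by linarith [hx.1]))

lemma powerSeries_bounds (h0 : ∀ d, 0 ≤ p d) (h1 : ∀ s : Finset ℕ, ∑ d ∈ s, p d ≤ 1) {x : ℝ}
    (hx : x ∈ Set.Icc (0 : ℝ) 1) : x ≤ powerSeries p x ∧ powerSeries p x ≤ 2 := by
  have hx0 : 0 ≤ 1 - x := by linarith [hx.2]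
  have hsum := summable_powerSeries h0 h1 hx
  obtain ⟨hs, hs1⟩ := summable_shift_of_sum_le_one h0 h1
  have hle : ∑' k : ℕ, p (k + 3) * (1 - x) ^ (k + 3) ≤ 1 - x := by
    calc _ ≤ ∑' k : ℕ, p (k + 3) * (1 - x) := by
          refine hsum.tsum_le_tsum (fun k => ?_) (hs.mul_right _)
          refine mul_le_mul_of_nonneg_left ?_ (h0 _)
          exact pow_le_of_le_one hx0 (by linarith [hx.1]) (by omega)
      _ = (∑' k : ℕ, p (k + 3)) * (1 - x) := tsum_mul_right
      _ ≤ 1 * (1 - x) := by gcongr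
      _ = 1 - x := one_mul _
  have hnn : 0 ≤ ∑' k : ℕ, p (k + 3) * (1 - x) ^ (k + 3) :=
    tsum_nonneg fun k => mul_nonneg (h0 _) (by positivity)
  unfold powerSeries
  constructor <;> linarith [hx.1, hx.2]

lemma continuousOn_powerSeries (h0 : ∀ d, 0 ≤ p d) (h1 : ∀ s : Finset ℕ, ∑ d ∈ s, p d ≤ 1) :
    ContinuousOn (powerSeries p) (Set.Icc 0 1) := by
  unfold powerSeries
  refine ContinuousOn.sub (by fun_prop) ?_
  refine continuousOn_tsum (fun k => by fun_prop) (summable_shift_of_sum_le_one h0 h1).1 ?_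
  intro k x hx
  have hx0 : 0 ≤ 1 - x := by linarith [hx.2]
  rw [Real.norm_of_nonneg (mul_nonneg (h0 _) (by positivity))]
  exact mul_le_of_le_one_right (h0 _) (pow_le_one₀ hx0 (by linarith [hx.1]))

lemma intervalIntegrable_log_powerSeries (h0 : ∀ d, 0 ≤ p d)
    (h1 : ∀ s : Finset ℕ, ∑ d ∈ s, p d ≤ 1) :
    IntervalIntegrable (fun x => Real.log (powerSeries p x)) MeasureTheory.volume 0 1 := by
  have hbound : IntervalIntegrable (fun x => Real.log 2 + |Real.log x|) MeasureTheory.volume 0 1 :=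
    intervalIntegrable_const.add intervalIntegral.intervalIntegrable_log'.abs
  refine hbound.mono_fun ?_ ?_
  · rw [Set.uIoc_of_le zero_le_one]
    refine (Real.measurable_log.comp_aemeasurable ?_).aestronglyMeasurable
    exact ((continuousOn_powerSeries h0 h1).mono Set.Ioc_subset_Icc_self).aemeasurable
      measurableSet_Ioc
  · rw [Set.uIoc_of_le zero_le_one]
    refine (MeasureTheory.ae_restrict_iff' measurableSet_Ioc).2 (Eventually.of_forall ?_)
    intro x hx
    obtain ⟨hl, hu⟩ := powerSeries_bounds h0 h1 ⟨hx.1.le, hx.2⟩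
    have hpos := hx.1.trans_le hl
    have h2 : 0 ≤ Real.log 2 := Real.log_nonneg one_le_two
    have hl' := Real.log_le_log hx.1 hl
    have hu' := Real.log_le_log hpos hu
    simp only
    rw [Real.norm_eq_abs, Real.norm_of_nonneg (by positivity), abs_le]
    constructor
    · linarith [neg_abs_le (Real.log x)]
    · linarith [abs_nonneg (Real.log x)]

end PowerSeries

/-! ### Sums as integrals of step functions -/

lemma integral_comp_floor (h : ℕ → ℝ) {N : ℕ} (hN : 0 < N) :
    IntervalIntegrable (fun t : ℝ => h ⌊t * N⌋₊) MeasureTheory.volume 0 1 ∧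
      N * ∫ t in (0 : ℝ)..1, h ⌊t * N⌋₊ = ∑ i ∈ Finset.range N, h i := by
  have hN0 : (N : ℝ) ≠ 0 := by exact_mod_cast hN.ne'
  have heq : ∀ k : ℕ, Set.EqOn (fun _ : ℝ => h k) (fun s => h ⌊s⌋₊) (Set.Ioo (k : ℝ) (k + 1 : ℕ)) := by
    intro k s hs
    have : ⌊s⌋₊ = k := by
      rw [Nat.floor_eq_iff (k.cast_nonneg.trans hs.1.le)]
      exact ⟨hs.1.le, by exact_mod_cast hs.2⟩
    simp [this]
  have hle : ∀ k : ℕ, (k : ℝ) ≤ (k + 1 : ℕ) := fun k => by push_cast; linarith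
  have hint : ∀ k : ℕ, IntervalIntegrable (fun s : ℝ => h ⌊s⌋₊) MeasureTheory.volume k (k + 1 : ℕ) :=
    fun k => (intervalIntegrable_const (c := h k)).congr_uIoo
      (by rw [Set.uIoo_of_le (hle k)]; exact heq k)
  have hval : ∀ k : ℕ, ∫ s in (k : ℝ)..(k + 1 : ℕ), h ⌊s⌋₊ = h k := by
    intro k
    rw [intervalIntegral.integral_of_le (hle k), MeasureTheory.integral_Ioc_eq_integral_Ioo,
      ← MeasureTheory.setIntegral_congr_fun measurableSet_Ioo (heq k)]
    simp
  have hI := IntervalIntegrable.trans_iterate (a := fun k : ℕ => (k : ℝ)) (n := N)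
    fun k _ => hint k
  have hS := intervalIntegral.sum_integral_adjacent_intervals (a := fun k : ℕ => (k : ℝ)) (n := N)
    fun k _ => hint k
  simp only [hval, Nat.cast_zero] at hS hI
  constructor
  · have := hI.comp_mul_right (c := (N : ℝ))
    simpa [hN0] using this
  · rw [intervalIntegral.integral_comp_mul_right (fun s => h ⌊s⌋₊) hN0, hS]
    simp [hN0]

lemma tendsto_floor_add_one_sub_div {ι : Type*} {l : Filter ι} {N : ι → ℕ}
    (hN : Tendsto N l atTop) {t : ℝ} (ht : 0 ≤ t) (d : ℕ) :
    Tendsto (fun n => ((⌊t * N n⌋₊ + 1 - d : ℕ) : ℝ) / N n) l (𝓝 t) := by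
  have hNR : Tendsto (fun n => (N n : ℝ)) l atTop := tendsto_natCast_atTop_atTop.comp hN
  have h1 : Tendsto (fun n => (⌊t * N n⌋₊ : ℝ) / N n) l (𝓝 t) :=
    (tendsto_nat_floor_mul_div_atTop ht).comp hNR
  have h2 : ∀ c : ℝ, Tendsto (fun n => (⌊t * N n⌋₊ : ℝ) / N n + c / N n) l (𝓝 t) := fun c => by
    simpa using h1.add (hNR.const_div_atTop c)
  refine tendsto_of_tendsto_of_tendsto_of_le_of_le (h2 (1 - d)) (h2 1) (fun n => ?_) fun n => ?_
  · simp only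
    rw [← add_div]
    gcongr
    have : ⌊t * N n⌋₊ + 1 ≤ (⌊t * N n⌋₊ + 1 - d) + d := by omega
    have : (⌊t * N n⌋₊ : ℝ) + 1 ≤ ((⌊t * N n⌋₊ + 1 - d : ℕ) : ℝ) + d := by exact_mod_cast this
    linarith
  · simp only
    rw [← add_div]
    gcongr
    exact_mod_cast Nat.sub_le _ _

lemma mul_log_sub_le_log_factorial (N : ℕ) :
    N * Real.log N - N ≤ Real.log N.factorial := by
  rcases Nat.eq_zero_or_pos N with rfl | hN
  · simp
  have hN' : (0 : ℝ) < N := by exact_mod_cast hN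
  have h := Real.log_le_log (by positivity) (Real.pow_div_factorial_le_exp (N : ℝ) hN'.le N)
  rw [Real.log_exp, Real.log_div (by positivity) (by positivity), Real.log_pow] at h
  linarith

/-! ### Families of spanning trees of grids -/

namespace TreeFamily

variable (F : TreeFamily)

instance : F.toInfinity.NeBot :=
  frequently_mem_iff_neBot.1 (Nat.frequently_atTop_iff_infinite.2 F.index_infinite)

instance : F.toInfinity.IsCountablyGenerated := by
  unfold toInfinity
  infer_instance

lemma eventually_index : ∀ᶠ n in F.toInfinity, n ∈ F.index :=
  eventually_inf_principal.2 (Eventually.of_forall fun _ h => h)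

lemma tendsto_id_toInfinity : Tendsto (fun n : ℕ => n) F.toInfinity atTop :=
  tendsto_id.mono_left inf_le_left

lemma card_tree_add_one {n : ℕ} (hn : n ∈ F.index) : (F.tree n).card + 1 = n ^ 2 := by
  rw [card_add_one_of_isSpanningTree (F.isSpanningTree n hn)]
  simp [sq]

lemma tendsto_card_tree : Tendsto (fun n => (F.tree n).card) F.toInfinity atTop := by
  refine tendsto_atTop.2 fun b => ?_
  filter_upwards [F.eventually_index, F.tendsto_id_toInfinity.eventually_ge_atTop (b + 1)]
    with n hn hb
  have := F.card_tree_add_one hn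
  nlinarith

lemma tendsto_card_tree_div_sq :
    Tendsto (fun n => ((F.tree n).card : ℝ) / (n : ℝ) ^ 2) F.toInfinity (𝓝 1) := by
  have h : Tendsto (fun n : ℕ => 1 - 1 / (n : ℝ) ^ 2) F.toInfinity (𝓝 (1 - 0)) := by
    refine tendsto_const_nhds.sub (Tendsto.const_div_atTop ?_ 1)
    exact (tendsto_pow_atTop two_ne_zero).comp
      (tendsto_natCast_atTop_atTop.comp F.tendsto_id_toInfinity)
  rw [sub_zero] at h
  refine h.congr' ?_
  filter_upwards [F.eventually_index, F.tendsto_id_toInfinity.eventually_ge_atTop 1] with n hn h1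
  have h2 : ((F.tree n).card : ℝ) + 1 = (n : ℝ) ^ 2 := by exact_mod_cast F.card_tree_add_one hn
  have h3 : (0 : ℝ) < (n : ℝ) ^ 2 := by positivity
  field_simp
  linarith

variable {F} {p : ℕ → ℝ}

lemma ConvergesTo.nonneg (h : F.ConvergesTo p) (d : ℕ) : 0 ≤ p d :=
  ge_of_tendsto' (h d) fun _ => degreeMass_nonneg _ _ _

lemma ConvergesTo.sum_le_one (h : F.ConvergesTo p) (s : Finset ℕ) : ∑ d ∈ s, p d ≤ 1 :=
  le_of_tendsto' (tendsto_finsetSum s fun d _ => h d) fun _ => sum_degreeMass_le_one _ _ _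

variable (F) in
/-- The bound `averageHarmBound` for the `n`-th tree in units of the number of branches, at the time
when the proportion `t` of the branches has been inserted. -/
noncomputable def harmProfile (n : ℕ) (t : ℝ) : ℝ :=
  averageHarmBound (grid n) (F.tree n) ⌊t * (F.tree n).card⌋₊ / (F.tree n).card

lemma floor_mul_lt {N : ℕ} {t : ℝ} (ht : t ∈ Set.Ioo (0 : ℝ) 1) (hN : 0 < N) : ⌊t * N⌋₊ < N := by
  have hN' : (0 : ℝ) < N := by exact_mod_cast hN
  rw [Nat.floor_lt (mul_nonneg ht.1.le hN'.le)]
  nlinarith [ht.2]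

lemma harmProfile_bounds {n : ℕ} (hn : n ∈ F.index) (hN : 0 < (F.tree n).card) {t : ℝ}
    (ht : t ∈ Set.Ioo (0 : ℝ) 1) : 0 < F.harmProfile n t ∧ F.harmProfile n t ≤ 4 := by
  have hi := floor_mul_lt ht hN
  have hN1 : (1 : ℝ) ≤ (F.tree n).card := by exact_mod_cast hN
  have hb := averageHarmBound_bounds (grid n) (F.tree n) hi.le
  have hM : ((chords (grid n) (F.tree n)).card : ℝ) ≤ (F.tree n).card + 2 := by
    exact_mod_cast card_chords_grid_le (F.isSpanningTree n hn)
  have hi' : (⌊t * (F.tree n).card⌋₊ : ℝ) < (F.tree n).card := by exact_mod_cast hi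
  unfold harmProfile
  refine ⟨div_pos (by linarith) (by linarith), ?_⟩
  rw [div_le_iff₀ (by linarith)]
  linarith

/-- Finitely many degrees suffice: all other chords may be counted as harmful throughout, which is
also how the limiting series counts the degree mass that escapes to infinity. -/
lemma ConvergesTo.eventually_harmProfile_le (h : F.ConvergesTo p) {t : ℝ}
    (ht : t ∈ Set.Ioo (0 : ℝ) 1) {δ : ℝ} (hδ : 0 < δ) :
    ∀ᶠ n in F.toInfinity, F.harmProfile n t < powerSeries p (1 - t) + δ := by
  have hsum := summable_powerSeries h.nonneg h.sum_le_one
    (x := 1 - t) ⟨by linarith [ht.2], by linarith [ht.1]⟩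
  simp only [sub_sub_cancel] at hsum
  -- truncate the series so that less than `δ` of its sum is lost
  obtain ⟨K, hK⟩ := ((Tendsto.eventually_const_lt
    (show ∑' k, p (k + 3) * t ^ (k + 3) - δ < ∑' k, p (k + 3) * t ^ (k + 3) by linarith)
    hsum.hasSum.tendsto_sum_nat)).exists
  have hNR : Tendsto (fun n => ((F.tree n).card : ℝ)) F.toInfinity atTop :=
    tendsto_natCast_atTop_atTop.comp F.tendsto_card_tree
  have hlim : Tendsto (fun n => (1 - (⌊t * (F.tree n).card⌋₊ : ℝ) / (F.tree n).card) +
      (1 + 2 / ((F.tree n).card : ℝ)) * (1 - ∑ k ∈ Finset.range K,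
        degreeMass (grid n) (F.tree n) (k + 3) *
          (((⌊t * (F.tree n).card⌋₊ + 1 - (k + 3) : ℕ) : ℝ) / (F.tree n).card) ^ (k + 3)))
      F.toInfinity (𝓝 ((1 - t) + (1 + 0) *
        (1 - ∑ k ∈ Finset.range K, p (k + 3) * t ^ (k + 3)))) := by
    refine (tendsto_const_nhds.sub ((tendsto_nat_floor_mul_div_atTop ht.1.le).comp hNR)).add
      ((tendsto_const_nhds.add (hNR.const_div_atTop 2)).mul (tendsto_const_nhds.sub
        (tendsto_finsetSum _ fun k _ => (h (k + 3)).mul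
          ((tendsto_floor_add_one_sub_div F.tendsto_card_tree ht.1.le _).pow _))))
  have hlt : (1 - t) + (1 + 0) * (1 - ∑ k ∈ Finset.range K, p (k + 3) * t ^ (k + 3)) <
      powerSeries p (1 - t) + δ := by
    simp only [powerSeries, sub_sub_cancel]
    linarith
  filter_upwards [hlim.eventually_lt_const hlt, F.eventually_index,
    F.tendsto_card_tree.eventually_ge_atTop 1] with n hn hni hN
  refine lt_of_le_of_lt ?_ hn
  have hi := floor_mul_lt ht hN
  have hN0 : (0 : ℝ) < (F.tree n).card := by exact_mod_cast hN
  have hM : ((chords (grid n) (F.tree n)).card : ℝ) ≤ (F.tree n).card + 2 := by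
    exact_mod_cast card_chords_grid_le (F.isSpanningTree n hni)
  have hb := averageHarmBound_le (grid n) (F.tree n) ⌊t * (F.tree n).card⌋₊
    ((Finset.range K).map (addRightEmbedding 3))
  simp only [Finset.sum_map, addRightEmbedding_apply] at hb
  set i := ⌊t * (F.tree n).card⌋₊
  set N := ((F.tree n).card : ℝ)
  set S := ∑ k ∈ Finset.range K, degreeMass (grid n) (F.tree n) (k + 3) *
          (((i + 1 - (k + 3) : ℕ) : ℝ) / N) ^ (k + 3)
  have hS : S ≤ 1 := by
    refine le_trans (Finset.sum_le_sum (g := fun k => degreeMass (grid n) (F.tree n) (k + 3))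
      fun k _ => ?_) ?_
    · refine mul_le_of_le_one_right (degreeMass_nonneg _ _ _) (pow_le_one₀ (by positivity) ?_)
      refine div_le_one_of_le₀ ?_ hN0.le
      exact Nat.cast_le.2 (by omega : i + 1 - (k + 3) ≤ (F.tree n).card)
    · simpa using sum_degreeMass_le_one (grid n) (F.tree n)
        ((Finset.range K).map (addRightEmbedding 3))
  have hb' : averageHarmBound (grid n) (F.tree n) i ≤ (N - i) + (N + 2) * (1 - S) :=
    hb.trans (by gcongr)
  unfold harmProfile
  rw [div_le_iff₀ hN0]
  refine hb'.trans (le_of_eq ?_)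
  field_simp

lemma ConvergesTo.powerSeries_pos (h : F.ConvergesTo p) {t : ℝ} (ht : t ∈ Set.Ioo (0 : ℝ) 1) :
    0 < powerSeries p (1 - t) :=
  lt_of_lt_of_le (by linarith [ht.2]) (powerSeries_bounds h.nonneg h.sum_le_one
    (x := 1 - t) ⟨by linarith [ht.2], by linarith [ht.1]⟩).1

lemma ae_mem_Ioo_of_mem_uIoc :
    ∀ᵐ t : ℝ, t ∈ Set.uIoc (0 : ℝ) 1 → t ∈ Set.Ioo (0 : ℝ) 1 := by
  have : ∀ᵐ t : ℝ, t ≠ 1 := by simp [MeasureTheory.ae_iff]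
  filter_upwards [this] with t ht1 ht
  rw [Set.uIoc_of_le zero_le_one] at ht
  exact ⟨ht.1, lt_of_le_of_ne ht.2 ht1⟩

lemma ConvergesTo.aestronglyMeasurable_log_max (h : F.ConvergesTo p) (n : ℕ) :
    MeasureTheory.AEStronglyMeasurable
      (fun t => Real.log (max (F.harmProfile n t) (powerSeries p (1 - t))))
      (MeasureTheory.volume.restrict (Set.uIoc (0 : ℝ) 1)) := by
  rw [Set.uIoc_of_le zero_le_one]
  refine (Real.measurable_log.comp_aemeasurable (AEMeasurable.max ?_ ?_)).aestronglyMeasurable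
  · refine Measurable.aemeasurable ?_
    exact ((measurable_from_nat (f := averageHarmBound (grid n) (F.tree n))).comp
      (Nat.measurable_floor.comp (measurable_id.mul_const _))).div_const _
  · refine ContinuousOn.aemeasurable ?_ measurableSet_Ioc
    refine (continuousOn_powerSeries h.nonneg h.sum_le_one).comp (by fun_prop) fun t ht => ?_
    exact ⟨by linarith [ht.2], by linarith [ht.1]⟩

lemma ConvergesTo.norm_log_max_le (h : F.ConvergesTo p) {n : ℕ} (hn : n ∈ F.index)
    (hN : 0 < (F.tree n).card) {t : ℝ} (ht : t ∈ Set.Ioo (0 : ℝ) 1) :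
    ‖Real.log (max (F.harmProfile n t) (powerSeries p (1 - t)))‖ ≤
      Real.log 4 + |Real.log (powerSeries p (1 - t))| := by
  have hg := h.powerSeries_pos ht
  have hg2 := (powerSeries_bounds h.nonneg h.sum_le_one
    (x := 1 - t) ⟨by linarith [ht.2], by linarith [ht.1]⟩).2
  have hF := harmProfile_bounds hn hN ht
  have hl := Real.log_le_log hg (le_max_right (F.harmProfile n t) _)
  have hu := Real.log_le_log (lt_max_of_lt_right hg)
    (max_le hF.2 (by linarith : powerSeries p (1 - t) ≤ 4))
  have h4 : 0 ≤ Real.log 4 := Real.log_nonneg (by norm_num)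
  rw [Real.norm_eq_abs, abs_le]
  constructor
  · linarith [neg_abs_le (Real.log (powerSeries p (1 - t)))]
  · linarith [abs_nonneg (Real.log (powerSeries p (1 - t)))]

lemma ConvergesTo.intervalIntegrable_log_max_bound (h : F.ConvergesTo p) :
    IntervalIntegrable (fun t => Real.log 4 + |Real.log (powerSeries p (1 - t))|)
      MeasureTheory.volume 0 1 := by
  refine intervalIntegrable_const.add (IntervalIntegrable.abs ?_)
  have := (intervalIntegrable_log_powerSeries h.nonneg h.sum_le_one).comp_sub_left 1
  simpa using this.symm

lemma ConvergesTo.intervalIntegrable_log_max (h : F.ConvergesTo p) {n : ℕ} (hn : n ∈ F.index)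
    (hN : 0 < (F.tree n).card) :
    IntervalIntegrable (fun t => Real.log (max (F.harmProfile n t) (powerSeries p (1 - t))))
      MeasureTheory.volume 0 1 := by
  refine h.intervalIntegrable_log_max_bound.mono_fun' (h.aestronglyMeasurable_log_max n) ?_
  refine (MeasureTheory.ae_restrict_iff' measurableSet_uIoc).2 ?_
  filter_upwards [ae_mem_Ioo_of_mem_uIoc] with t ht ht'
  exact h.norm_log_max_le hn hN (ht ht')

/-- The maximum with the limiting power series turns the upper limit of the profile into a limit and
bounds it away from zero, which makes dominated convergence applicable. -/
lemma ConvergesTo.tendsto_integral_log_max (h : F.ConvergesTo p) :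
    Tendsto (fun n => ∫ t in (0 : ℝ)..1,
        Real.log (max (F.harmProfile n t) (powerSeries p (1 - t)))) F.toInfinity
      (𝓝 (∫ t in (0 : ℝ)..1, Real.log (powerSeries p t))) := by
  have hflip : ∫ t in (0 : ℝ)..1, Real.log (powerSeries p t) =
      ∫ t in (0 : ℝ)..1, Real.log (powerSeries p (1 - t)) := by
    rw [intervalIntegral.integral_comp_sub_left (fun t => Real.log (powerSeries p t))]
    simp
  rw [hflip]
  refine intervalIntegral.tendsto_integral_filter_of_dominated_convergence
    _ (Eventually.of_forall h.aestronglyMeasurable_log_max) ?_ h.intervalIntegrable_log_max_bound ?_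
  · filter_upwards [F.eventually_index, F.tendsto_card_tree.eventually_ge_atTop 1] with n hn hN
    filter_upwards [ae_mem_Ioo_of_mem_uIoc] with t ht ht'
    exact h.norm_log_max_le hn hN (ht ht')
  · filter_upwards [ae_mem_Ioo_of_mem_uIoc] with t ht ht'
    refine Tendsto.log ?_ (h.powerSeries_pos (ht ht')).ne'
    refine Metric.tendsto_nhds.2 fun δ hδ => ?_
    filter_upwards [h.eventually_harmProfile_le (ht ht') hδ] with n hn
    rw [Real.dist_eq, abs_of_nonneg (sub_nonneg.2 (le_max_right _ _)), sub_lt_iff_lt_add']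
    exact max_lt hn (by linarith)

lemma prob_le_one (n : ℕ) : F.prob n ≤ 1 :=
  ENNReal.toReal_le_of_le_ofReal zero_le_one (by simpa using PMF.coe_le_one _ _)

lemma prob_nonneg (n : ℕ) : 0 ≤ F.prob n := ENNReal.toReal_nonneg

/-- The sum of logarithms in the bound for a single tree is the integral of a step function; with
`N! ≥ (N / e) ^ N` the factors `N` cancel. -/
lemma ConvergesTo.le_log_prob (h : F.ConvergesTo p) {n : ℕ} (hn : n ∈ F.index)
    (hN : 0 < (F.tree n).card) :
    0 < F.prob n ∧
    (F.tree n).card * (-1 - ∫ t in (0 : ℝ)..1,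
        Real.log (max (F.harmProfile n t) (powerSeries p (1 - t)))) ≤ Real.log (F.prob n) := by
  obtain ⟨hpos, hlog⟩ := log_probMST_ge (F.isSpanningTree n hn)
  refine ⟨hpos, le_trans ?_ hlog⟩
  set N := (F.tree n).card with hNdef
  have hN0 : (0 : ℝ) < N := by exact_mod_cast hN
  obtain ⟨hint, hsum⟩ := integral_comp_floor
    (fun i => Real.log (averageHarmBound (grid n) (F.tree n) i / N)) hN
  have hsum' : ∑ i ∈ Finset.range N, Real.log (averageHarmBound (grid n) (F.tree n) i) =
      (∑ i ∈ Finset.range N, Real.log (averageHarmBound (grid n) (F.tree n) i / N)) +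
        N * Real.log N := by
    have : (N : ℝ) * Real.log N = ∑ _i ∈ Finset.range N, Real.log N := by simp
    rw [this, ← Finset.sum_add_distrib]
    refine Finset.sum_congr rfl fun i hi => ?_
    have hi := Finset.mem_range.1 hi
    have hb := (averageHarmBound_bounds (grid n) (F.tree n) (i := i) hi.le).1
    have hi' : (i : ℝ) < N := by exact_mod_cast hi
    rw [Real.log_div (by linarith) hN0.ne']
    ring
  have hmono : ∫ t in (0 : ℝ)..1,
        Real.log (averageHarmBound (grid n) (F.tree n) ⌊t * N⌋₊ / N) ≤
      ∫ t in (0 : ℝ)..1, Real.log (max (F.harmProfile n t) (powerSeries p (1 - t))) := by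
    refine intervalIntegral.integral_mono_on_of_le_Ioo zero_le_one hint
      (h.intervalIntegrable_log_max hn hN) fun t ht => ?_
    exact Real.log_le_log (harmProfile_bounds hn hN ht).1 (le_max_left _ _)
  have hfac := mul_log_sub_le_log_factorial N
  have := mul_le_mul_of_nonneg_left hmono hN0.le
  rw [hsum', ← hsum]
  linarith

/-- A convergent minorant of the roots `Prob(T_n) ^ (1 / n²)` whose limit is `1 / (e f̄)`. -/
lemma ConvergesTo.exists_tendsto_le_prob_rpow (h : F.ConvergesTo p) :
    ∃ a : ℕ → ℝ,
      Tendsto a F.toInfinity (𝓝 (1 / (Real.exp 1 * geometricMean (powerSeries p)))) ∧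
      ∀ᶠ n in F.toInfinity, a n ≤ F.prob n ^ (1 / (n : ℝ) ^ 2) := by
  refine ⟨fun n => Real.exp (((F.tree n).card : ℝ) / (n : ℝ) ^ 2 * (-1 - ∫ t in (0 : ℝ)..1,
    Real.log (max (F.harmProfile n t) (powerSeries p (1 - t))))), ?_, ?_⟩
  · have hval : 1 / (Real.exp 1 * geometricMean (powerSeries p)) =
        Real.exp (1 * (-1 - ∫ t in (0 : ℝ)..1, Real.log (powerSeries p t))) := by
      rw [geometricMean, ← Real.exp_add, one_div, ← Real.exp_neg]
      ring_nf
    rw [hval]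
    exact (Real.continuous_exp.tendsto _).comp
      (F.tendsto_card_tree_div_sq.mul (tendsto_const_nhds.sub h.tendsto_integral_log_max))
  · filter_upwards [F.eventually_index, F.tendsto_card_tree.eventually_ge_atTop 1] with n hn hN
    obtain ⟨hpos, hlog⟩ := h.le_log_prob hn hN
    rw [Real.rpow_def_of_pos hpos, Real.exp_le_exp, mul_one_div, div_mul_eq_mul_div]
    gcongr

end TreeFamily

end GridMST


theorem theorem2 (F : GridMST.TreeFamily) (p : ℕ → ℝ)
    (h_bounded : F.IsBounded) (h_convergent : F.ConvergesTo p)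
    (h_indep : F.IsNeighborIndependent) :
    -- the power series converges on `[0, 1]`, is positive on `(0, 1]`, and its logarithm is
    -- integrable, so that the geometric mean is well defined
    (∀ x ∈ Set.Icc (0 : ℝ) 1, Summable fun k : ℕ => p (k + 3) * (1 - x) ^ (k + 3)) ∧
    (∀ x ∈ Set.Ioc (0 : ℝ) 1, 0 < GridMST.powerSeries p x) ∧
    IntervalIntegrable (fun x => Real.log (GridMST.powerSeries p x)) MeasureTheory.volume 0 1 ∧
    -- the lower bound for the lower decay base
    1 / (Real.exp 1 * GridMST.geometricMean (GridMST.powerSeries p)) ≤ F.lowerDecayBase ∧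
    -- in other words, `Prob(T_n) ≥ (1 / (e f̄) + o(1)) ^ (n²)`
    (∃ ε : ℕ → ℝ, Tendsto ε F.toInfinity (𝓝 0) ∧ ∀ᶠ n in F.toInfinity,
      (1 / (Real.exp 1 * GridMST.geometricMean (GridMST.powerSeries p)) + ε n) ^ (n ^ 2)
        ≤ F.prob n) := by
  have h0 := h_convergent.nonneg
  have h1 := h_convergent.sum_le_one
  refine ⟨fun x hx => GridMST.summable_powerSeries h0 h1 hx, fun x hx =>
    hx.1.trans_le (GridMST.powerSeries_bounds h0 h1 ⟨hx.1.le, hx.2⟩).1,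
    GridMST.intervalIntegrable_log_powerSeries h0 h1, ?_⟩
  obtain ⟨a, ha, hle⟩ := h_convergent.exists_tendsto_le_prob_rpow
  set L := 1 / (Real.exp 1 * GridMST.geometricMean (GridMST.powerSeries p)) with hL
  have hL0 : 0 ≤ L := by
    rw [hL, GridMST.geometricMean]
    positivity
  have hx0 : ∀ n, 0 ≤ F.prob n ^ (1 / (n : ℝ) ^ 2) := fun n =>
    Real.rpow_nonneg (GridMST.TreeFamily.prob_nonneg n) _
  refine ⟨?_, fun n => min 0 (F.prob n ^ (1 / (n : ℝ) ^ 2) - L), ?_, ?_⟩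
  · rw [← ha.liminf_eq]
    refine liminf_le_liminf hle ha.isBoundedUnder_ge ?_
    refine IsBoundedUnder.isCoboundedUnder_ge (isBoundedUnder_of ⟨1, fun n => ?_⟩)
    exact Real.rpow_le_one (GridMST.TreeFamily.prob_nonneg n) (GridMST.TreeFamily.prob_le_one n)
      (by positivity)
  · have hmin : Tendsto (fun n => min 0 (a n - L)) F.toInfinity (𝓝 0) := by
      simpa using (tendsto_const_nhds (x := (0 : ℝ))).min (ha.sub_const L)
    refine tendsto_of_tendsto_of_tendsto_of_le_of_le' hmin tendsto_const_nhds ?_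
      (Eventually.of_forall fun n => min_le_left _ _)
    filter_upwards [hle] with n hn
    gcongr
  · filter_upwards [F.tendsto_id_toInfinity.eventually_ge_atTop 1] with n hn
    have hbase : L + min 0 (F.prob n ^ (1 / (n : ℝ) ^ 2) - L) =
        min L (F.prob n ^ (1 / (n : ℝ) ^ 2)) := by
      rw [← min_add_add_left]
      simp
    rw [hbase]
    calc _ ≤ (F.prob n ^ (1 / (n : ℝ) ^ 2)) ^ (n ^ 2) :=
          pow_le_pow_left₀ (le_min hL0 (hx0 n)) (min_le_right _ _) _
      _ = F.prob n := by
          have := Real.rpow_inv_natCast_pow (GridMST.TreeFamily.prob_nonneg (F := F) n)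
            (n := n ^ 2) (by positivity)
          simpa [one_div] using this
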